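/- A presentation of a countable group $G$ is given by a generating set $X=\{x_1,x_2,\dots\}$, finite or infinite, with an effective indexing; words over $X\cup X^{-1}$ are read as elements of $G$. The group $G$ is computable with respect to $X$ if the set of words over $X\cup X^{-1}$ that represent $1$ in $G$ is recursive, and computable if this holds for some such $X$. A bi-order on $G$ is a linear order invariant under left and right multiplication; $G$ is bi-orderable if it has one. A bi-order $\preceq$ is computable with respect to $X$ if the set of pairs $(u,v)$ of words over $X\cup X^{-1}$ with $u\preceq v$ in $G$ is recursive. There exists a computable bi-orderable group $G$ that has no presentation with a computable bi-order, that is, no bi-order on $G$ is computable with respect to any effectively indexed generating set of $G$. Moreover, $G$ can be chosen to be two-generated (and computable with respect to a two-element generating family) and solvable of derived length exactly $3$. -/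

import Mathlib

/-- The element of `G` represented by a word over the alphabet `X ∪ X⁻¹`, where the generating set
`X` is given as a family `x : α → G`. A word is a list of letters: `(a, true)` stands for `x a` and
`(a, false)` for `(x a)⁻¹`. -/
def wordVal {α G : Type*} [Group G] (x : α → G) (w : List (α × Bool)) : G :=
  FreeGroup.lift x (FreeGroup.mk w)

/-- The family `x` generates `G`, that is, `G = ⟨X⟩`. -/
def Generates {α G : Type*} [Group G] (x : α → G) : Prop :=
  Subgroup.closure (Set.range x) = ⊤

/-- `G` is a computable group with respect to the family `x`, whose indices come from an effectively
coded set: `x` generates `G`, and the set of words over `X ∪ X⁻¹` that represent `1` is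
recursive. -/
def IsComputableWith {α G : Type*} [Primcodable α] [Group G] (x : α → G) : Prop :=
  Generates x ∧ ComputablePred fun w : List (α × Bool) => wordVal x w = 1

/-- `G` is a computable group: it is computable with respect to some effectively indexed generating
family. -/
def IsComputableGroup (G : Type*) [Group G] : Prop :=
  ∃ (α : Type) (_ : Primcodable α) (x : α → G), IsComputableWith x

/-- `le` is a bi-order on `G`: a linear order invariant under left and right multiplication. -/
structure IsBiOrder {G : Type*} [Group G] (le : G → G → Prop) : Prop where
  refl : ∀ a, le a a
  trans : ∀ a b c, le a b → le b c → le a c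
  antisymm : ∀ a b, le a b → le b a → a = b
  total : ∀ a b, le a b ∨ le b a
  mul_left : ∀ a b c, le a b → le (c * a) (c * b)
  mul_right : ∀ a b c, le a b → le (a * c) (b * c)

/-- `G` is bi-orderable. -/
def IsBiOrderable (G : Type*) [Group G] : Prop :=
  ∃ le : G → G → Prop, IsBiOrder le

/-- The relation `le` on `G` is computable with respect to the family `x`: `x` generates `G`, and
the set of pairs of words `(u, v)` with `u ≤ v` in `G` is recursive. -/
def IsComputableOrderWith {α G : Type*} [Primcodable α] [Group G] (x : α → G)
    (le : G → G → Prop) : Prop :=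
  Generates x ∧
    ComputablePred fun p : List (α × Bool) × List (α × Bool) =>
      le (wordVal x p.1) (wordVal x p.2)

/-- `G` has a presentation with a computable bi-order: some bi-order on `G` is computable with
respect to some effectively indexed generating family of `G`, finite or infinite. (The relators are
then all words that represent `1`; they form a recursive set, as the order is antisymmetric.) -/
def HasComputableBiOrder (G : Type*) [Group G] : Prop :=
  ∃ (α : Type) (_ : Primcodable α) (x : α → G) (le : G → G → Prop),
    IsBiOrder le ∧ IsComputableOrderWith x le

/-- `G` is solvable of derived length exactly `n`: the `n`-th term of the derived series is trivial,
and no earlier term is. -/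
def HasDerivedLength (G : Type*) [Group G] (n : ℕ) : Prop :=
  derivedSeries G n = ⊥ ∧ ∀ m < n, derivedSeries G m ≠ ⊥

/-! The group is a two-generated subgroup, generated by `a` and `t`, of a central extension of
`ℤ[T;T⁻¹] ⋊ ℤ` by the real vector space of sequences. The commutators `⁅a, t⁻ᵏ a tᵏ⁆` are central,
and the cocycle `pairing ρ` is chosen so that `k = 2n + 2` gives the basis vector `eₙ` and `k = 2n +
1` gives `ρ n • eₙ`. Call these commutators `Yₙ` and `Xₙ`.

The slopes encode the diagonal halting problem (`haltingSlope`). If program `n` halts on `n` with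
output 0, then `Xₙ` is a positive power of `Yₙ`; with output 1, it is a negative power; otherwise
the slope is `√2` and the two are independent. The exponent is as large as the halting time, so a
relation `c + ρ n * d = 0` with `c ≠ 0` forces that time to be at most `|c|`. Relations are
therefore decidable by bounded search (`add_haltingSlope_mul_eq_zero_iff`), and so is the word
problem.

Every bi-order gives `Xₙ` and `Yₙ` equal signs in the first case and opposite signs in the second.
If it were computable, comparing the signs would give a computable function with value 1 for equal
signs and 0 for opposite ones. Some program `n` computes it, and on input `n` it is wrong about its
own case (`exists_haltsAt_of_computable`).

A bi-order exists nevertheless: order lexicographically by the `ℤ` part, by the Laurent polynomial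
evaluated at a positive transcendental number, and by the central part. -/

namespace Primrec

/-! ### Primitive recursive integer arithmetic. -/

theorem int_ofNat : Primrec Int.ofNat :=
  Primrec.encode_iff.1 (Primrec.of_eq (f := fun n : ℕ => 2 * n)
    (Primrec.nat_mul.comp (.const 2) .id) fun _ => rfl)

theorem int_negSucc : Primrec Int.negSucc :=
  Primrec.encode_iff.1 (Primrec.of_eq (f := fun n : ℕ => 2 * n + 1)
    (Primrec.succ.comp (Primrec.nat_mul.comp (.const 2) .id)) fun _ => rfl)

theorem int_toNat : Primrec Int.toNat := by
  refine Primrec.of_eq (f := fun x : ℤ =>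
    bif (Encodable.encode x).bodd then 0 else (Encodable.encode x).div2)
    (Primrec.cond (Primrec.nat_bodd.comp Primrec.encode) (.const 0)
      (Primrec.nat_div2.comp Primrec.encode)) fun x => ?_
  cases x with
  | ofNat n => rw [show Encodable.encode (Int.ofNat n) = 2 * n from rfl]; simp [Nat.div2_val]
  | negSucc n => rw [show Encodable.encode (Int.negSucc n) = 2 * n + 1 from rfl]; simp

theorem int_toNat_neg : Primrec fun x : ℤ => (-x).toNat := by
  refine Primrec.of_eq (f := fun x : ℤ =>
    bif (Encodable.encode x).bodd then (Encodable.encode x).div2 + 1 else 0)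
    (Primrec.cond (Primrec.nat_bodd.comp Primrec.encode)
      (Primrec.succ.comp (Primrec.nat_div2.comp Primrec.encode)) (.const 0)) fun x => ?_
  cases x with
  | ofNat n => rw [show Encodable.encode (Int.ofNat n) = 2 * n from rfl]; simp
  | negSucc n =>
    rw [show Encodable.encode (Int.negSucc n) = 2 * n + 1 from rfl]
    have : (2 * n + 1).bodd = true := by simp
    rw [this, cond_true, Nat.div2_val]
    omega

/-- Writing an integer as the difference of its positive and negative parts reduces addition,
negation and multiplication to this case. -/
theorem int_natCast_sub : Primrec₂ fun m n : ℕ => (m : ℤ) - n := by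
  refine Primrec.of_eq (f := fun p : ℕ × ℕ =>
    if p.2 ≤ p.1 then Int.ofNat (p.1 - p.2) else Int.negSucc (p.2 - p.1 - 1))
    (Primrec.ite (Primrec.nat_le.comp .snd .fst)
      (int_ofNat.comp (Primrec.nat_sub.comp .fst .snd))
      (int_negSucc.comp (Primrec.nat_sub.comp (Primrec.nat_sub.comp .snd .fst) (.const 1))))
    fun p => ?_
  split_ifs with h
  · simp only [Int.ofNat_eq_natCast]; omega
  · dsimp only; omega

theorem int_add : Primrec₂ fun x y : ℤ => x + y := by
  refine Primrec.of_eq (f := fun p : ℤ × ℤ =>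
    ((p.1.toNat + p.2.toNat : ℕ) : ℤ) - ((-p.1).toNat + (-p.2).toNat : ℕ))
    (int_natCast_sub.comp
      (Primrec.nat_add.comp (int_toNat.comp .fst) (int_toNat.comp .snd))
      (Primrec.nat_add.comp (int_toNat_neg.comp .fst) (int_toNat_neg.comp .snd)))
    fun p => ?_
  dsimp only
  omega

theorem int_neg : Primrec fun x : ℤ => -x := by
  refine Primrec.of_eq (f := fun x : ℤ => ((-x).toNat : ℤ) - x.toNat)
    (int_natCast_sub.comp int_toNat_neg int_toNat) fun x => ?_
  omega

theorem int_sub : Primrec₂ fun x y : ℤ => x - y :=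
  Primrec.of_eq (int_add.comp .fst (int_neg.comp .snd)) fun _ => (sub_eq_add_neg _ _).symm

theorem int_mul : Primrec₂ fun x y : ℤ => x * y := by
  refine Primrec.of_eq (f := fun p : ℤ × ℤ =>
    ((p.1.toNat * p.2.toNat + (-p.1).toNat * (-p.2).toNat : ℕ) : ℤ) -
      (p.1.toNat * (-p.2).toNat + (-p.1).toNat * p.2.toNat : ℕ))
    (int_natCast_sub.comp
      (Primrec.nat_add.comp
        (Primrec.nat_mul.comp (int_toNat.comp .fst) (int_toNat.comp .snd))
        (Primrec.nat_mul.comp (int_toNat_neg.comp .fst) (int_toNat_neg.comp .snd)))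
      (Primrec.nat_add.comp
        (Primrec.nat_mul.comp (int_toNat.comp .fst) (int_toNat_neg.comp .snd))
        (Primrec.nat_mul.comp (int_toNat_neg.comp .fst) (int_toNat.comp .snd))))
    fun p => ?_
  have h (x : ℤ) : x = (x.toNat : ℤ) - ((-x).toNat : ℤ) := by omega
  conv_rhs => rw [h p.1, h p.2]
  push_cast
  ring

theorem int_natAbs : Primrec Int.natAbs := by
  refine Primrec.of_eq (f := fun x : ℤ => x.toNat + (-x).toNat)
    (Primrec.nat_add.comp int_toNat int_toNat_neg) fun x => ?_
  omega

end Primrec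

/-! ### Central extensions of `ℤ[T;T⁻¹] ⋊ ℤ`. -/

open scoped LaurentPolynomial in
/-- The set `ℤ × ℤ[T;T⁻¹] × L` with the group law of the extension of `ℤ[T;T⁻¹] ⋊ ℤ` by the central
subgroup `L` given by the cocycle `(p, q) ↦ φ (p(T⁻¹) q(T))`. -/
@[ext]
structure HallGroup {L : Type*} [AddCommGroup L] (φ : ℤ[T;T⁻¹] →+ L) where
  shift : ℤ
  poly : ℤ[T;T⁻¹]
  center : L

namespace HallGroup

open scoped LaurentPolynomial
open scoped commutatorElement
open LaurentPolynomial (T invert)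

variable {L : Type*} [AddCommGroup L] {φ : ℤ[T;T⁻¹] →+ L}

noncomputable instance : Mul (HallGroup φ) where
  mul g h := ⟨g.shift + h.shift, T h.shift * g.poly + h.poly,
    g.center + h.center + φ (invert (T h.shift * g.poly) * h.poly)⟩

noncomputable instance : One (HallGroup φ) where
  one := ⟨0, 0, 0⟩

noncomputable instance : Inv (HallGroup φ) where
  inv g := ⟨-g.shift, -(T (-g.shift) * g.poly), -g.center + φ (invert g.poly * g.poly)⟩

@[simp] theorem shift_mul (g h : HallGroup φ) : (g * h).shift = g.shift + h.shift := rfl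
@[simp] theorem poly_mul (g h : HallGroup φ) :
    (g * h).poly = T h.shift * g.poly + h.poly := rfl
@[simp] theorem center_mul (g h : HallGroup φ) :
    (g * h).center = g.center + h.center + φ (invert (T h.shift * g.poly) * h.poly) := rfl
@[simp] theorem shift_one : (1 : HallGroup φ).shift = 0 := rfl
@[simp] theorem poly_one : (1 : HallGroup φ).poly = 0 := rfl
@[simp] theorem center_one : (1 : HallGroup φ).center = 0 := rfl
@[simp] theorem shift_inv (g : HallGroup φ) : g⁻¹.shift = -g.shift := rfl
@[simp] theorem poly_inv (g : HallGroup φ) : g⁻¹.poly = -(T (-g.shift) * g.poly) := rfl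
@[simp] theorem center_inv (g : HallGroup φ) :
    g⁻¹.center = -g.center + φ (invert g.poly * g.poly) := rfl

theorem T_neg_mul_T (n : ℤ) : (T (-n) * T n : ℤ[T;T⁻¹]) = 1 := by
  rw [← LaurentPolynomial.T_add]; simp

noncomputable instance : Group (HallGroup φ) := Group.ofLeftAxioms
  (by
    intro g h k
    ext1
    · simp [add_assoc]
    · simp only [shift_mul, poly_mul, LaurentPolynomial.T_add]; ring
    -- The cocycle identity. As `φ` is only additive, it is proved in the ring first; it rests on
    -- the invariance of `p(T⁻¹) q(T)` under multiplying both `p` and `q` by `Tⁿ`.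
    · have key := congrArg φ (show invert (T h.shift * g.poly) * h.poly +
          invert (T k.shift * (T h.shift * g.poly + h.poly)) * k.poly =
          invert (T k.shift * h.poly) * k.poly +
          invert (T (h.shift + k.shift) * g.poly) * (T k.shift * h.poly + k.poly) by
        simp only [LaurentPolynomial.T_add, map_mul, map_add, LaurentPolynomial.invert_T]
        linear_combination (-T (-h.shift) * invert g.poly * h.poly) * T_neg_mul_T k.shift)
      rw [map_add, map_add, ← sub_eq_zero] at key
      simp only [shift_mul, poly_mul, center_mul]
      rw [← sub_eq_zero, ← key]
      abel)
  (by intro g; ext1 <;> simp)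
  (by
    intro g
    ext1 <;> simp)

/-- Each step of the series kills one coordinate: `shift` is a homomorphism to `ℤ`, `poly` is
additive where `shift` vanishes, and what remains is the abelian group `L`. -/
theorem derivedSeries_three (G : Subgroup (HallGroup φ)) : derivedSeries G 3 = ⊥ := by
  have comm (g h : HallGroup φ) (hg : g.shift = 0) (hh : h.shift = 0) :
      ⁅g, h⁆.poly = 0 := by
    simp [commutatorElement_def, hg, hh]
  have h1 : ∀ g ∈ derivedSeries G 1, (g : HallGroup φ).shift = 0 := by
    let K : Subgroup G :=
      { carrier := {g | (g : HallGroup φ).shift = 0}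
        one_mem' := rfl
        mul_mem' := fun {a b} ha hb => by
          simp only [Set.mem_ofPred_eq] at ha hb ⊢; simp [ha, hb]
        inv_mem' := fun {a} ha => by simp only [Set.mem_ofPred_eq] at ha ⊢; simp [ha] }
    have : derivedSeries G 1 ≤ K := by
      rw [derivedSeries_succ, Subgroup.commutator_le]
      intro g _ h _
      change (⁅(g : HallGroup φ), (h : HallGroup φ)⁆).shift = 0
      simp [commutatorElement_def]
    exact this
  have h2 : ∀ g ∈ derivedSeries G 2,
      (g : HallGroup φ).shift = 0 ∧ (g : HallGroup φ).poly = 0 := by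
    let K : Subgroup G :=
      { carrier := {g | (g : HallGroup φ).shift = 0 ∧ (g : HallGroup φ).poly = 0}
        one_mem' := ⟨rfl, rfl⟩
        mul_mem' := fun {a b} ha hb => by
          simp only [Set.mem_ofPred_eq] at ha hb ⊢; simp [ha, hb]
        inv_mem' := fun {a} ha => by simp only [Set.mem_ofPred_eq] at ha ⊢; simp [ha] }
    have : derivedSeries G 2 ≤ K := by
      rw [derivedSeries_succ, Subgroup.commutator_le]
      intro g hg h hh
      refine ⟨?_, comm g h (h1 g hg) (h1 h hh)⟩
      change (⁅(g : HallGroup φ), (h : HallGroup φ)⁆).shift = 0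
      simp [commutatorElement_def]
    exact this
  rw [derivedSeries_succ, eq_bot_iff, Subgroup.commutator_le]
  intro g hg h hh
  rw [Subgroup.mem_bot, commutatorElement_eq_one_iff_mul_comm]
  obtain ⟨hgs, hgp⟩ := h2 g hg
  obtain ⟨hhs, hhp⟩ := h2 h hh
  refine Subtype.ext (HallGroup.ext ?_ ?_ ?_)
  · simp [hgs, hhs]
  · simp [hgp, hhp]
  · simp [hgp, hhp, add_comm]

/-! ### A lexicographic bi-order. -/

theorem liouvilleNumber_two_pos : 0 < liouvilleNumber 2 :=
  (LiouvilleNumber.summable one_lt_two).tsum_pos (fun _ => by positivity) 0 (by positivity)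

/-- Evaluation at a transcendental real number. -/
noncomputable def liouvilleEval : ℤ[T;T⁻¹] →+* ℝ :=
  LaurentPolynomial.eval₂ (Int.castRingHom ℝ)
    (Units.mk0 (liouvilleNumber 2) liouvilleNumber_two_pos.ne')

theorem liouvilleEval_T_pos (n : ℤ) : 0 < liouvilleEval (T n) := by
  have := liouvilleNumber_two_pos
  rw [liouvilleEval, LaurentPolynomial.eval₂_T]
  simp only [Units.val_zpow_eq_zpow_val, Units.val_mk0]
  positivity

/-- A power of `T` clears denominators, and transcendence then excludes a nonzero polynomial. Hence
the order of `ℝ` pulls back to a linear order on `ℤ[T;T⁻¹]`. -/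
theorem liouvilleEval_injective : Function.Injective liouvilleEval := by
  rw [injective_iff_map_eq_zero]
  intro p hp
  obtain ⟨n, q, hq⟩ := LaurentPolynomial.exists_T_pow p
  have h : liouvilleEval (Polynomial.toLaurent q) = 0 := by rw [hq, map_mul, hp, zero_mul]
  rw [liouvilleEval, LaurentPolynomial.eval₂_toLaurent] at h
  have hq0 : q = 0 := by
    by_contra hne
    exact transcendental_liouvilleNumber (m := 2) le_rfl
      ⟨q, hne, by simpa [Polynomial.aeval_def] using h⟩
  rw [hq0, map_zero] at hq
  exact ((LaurentPolynomial.isUnit_T (R := ℤ) n).mul_left_eq_zero).1 hq.symm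

/-- The lexicographic order on a Hall group. -/
def lexLE [LinearOrder L] (g h : HallGroup φ) : Prop :=
  g.shift < h.shift ∨ g.shift = h.shift ∧
    (liouvilleEval g.poly < liouvilleEval h.poly ∨
      g.poly = h.poly ∧ g.center ≤ h.center)

/-- Translation acts on `poly` by adding a constant and multiplying by some `Tⁿ`, whose evaluation
is positive. When `shift` and `poly` agree, the cocycle terms agree too, so only the centers are
compared. -/
theorem isBiOrder_lexLE [LinearOrder L] [IsOrderedAddMonoid L] :
    IsBiOrder (lexLE (φ := φ)) where
  refl g := .inr ⟨rfl, .inr ⟨rfl, le_rfl⟩⟩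
  trans g h k := by
    rintro (a | ⟨a, b | ⟨b, c⟩⟩) (a' | ⟨a', b' | ⟨b', c'⟩⟩)
    · exact .inl (a.trans a')
    · exact .inl (a' ▸ a)
    · exact .inl (a' ▸ a)
    · exact .inl (a ▸ a')
    · exact .inr ⟨a.trans a', .inl (b.trans b')⟩
    · exact .inr ⟨a.trans a', .inl (b' ▸ b)⟩
    · exact .inl (a ▸ a')
    · exact .inr ⟨a.trans a', .inl (b ▸ b')⟩
    · exact .inr ⟨a.trans a', .inr ⟨b.trans b', c.trans c'⟩⟩
  antisymm g h := by
    rintro (a | ⟨a, b | ⟨b, c⟩⟩) (a' | ⟨a', b' | ⟨b', c'⟩⟩)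
    · exact (lt_asymm a a').elim
    · exact (a.ne a'.symm).elim
    · exact (a.ne a'.symm).elim
    · exact (a'.ne a.symm).elim
    · exact (lt_asymm b b').elim
    · exact (b.ne (congrArg _ b'.symm)).elim
    · exact (a'.ne a.symm).elim
    · exact (b'.ne (congrArg _ b.symm)).elim
    · exact HallGroup.ext a b (le_antisymm c c')
  total g h := by
    rcases lt_trichotomy g.shift h.shift with a | a | a
    · exact .inl (.inl a)
    · rcases lt_trichotomy (liouvilleEval g.poly) (liouvilleEval h.poly) with b | b | b
      · exact .inl (.inr ⟨a, .inl b⟩)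
      · have b := liouvilleEval_injective b
        exact (le_total g.center h.center).imp (fun c => .inr ⟨a, .inr ⟨b, c⟩⟩)
          (fun c => .inr ⟨a.symm, .inr ⟨b.symm, c⟩⟩)
      · exact .inr (.inr ⟨a.symm, .inl b⟩)
    · exact .inr (.inl a)
  mul_left g h k := by
    rintro (a | ⟨a, b | ⟨b, c⟩⟩)
    · exact .inl (by simpa using a)
    · exact .inr ⟨by simp [a], .inl (by simpa [a] using b)⟩
    · exact .inr ⟨by simp [a], .inr ⟨by simp [a, b], by simpa [a, b] using c⟩⟩
  mul_right g h k := by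
    rintro (a | ⟨a, b | ⟨b, c⟩⟩)
    · exact .inl (by simpa using a)
    · refine .inr ⟨by simp [a], .inl ?_⟩
      simpa [mul_comm] using (mul_lt_mul_iff_right₀ (liouvilleEval_T_pos k.shift)).2 b
    · exact .inr ⟨by simp [a], .inr ⟨by simp [b], by simpa [b] using c⟩⟩

/-! ### The standard generators and their commutators. -/

variable (φ) in
/-- The generator acting on `ℤ[T;T⁻¹]` by multiplication by `T`. -/
noncomputable def t : HallGroup φ := ⟨1, 0, 0⟩

variable (φ) in
/-- The generator corresponding to `1 : ℤ[T;T⁻¹]`. -/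
noncomputable def a : HallGroup φ := ⟨0, 1, 0⟩

@[simp] theorem shift_t : (t φ).shift = 1 := rfl
@[simp] theorem poly_t : (t φ).poly = 0 := rfl
@[simp] theorem center_t : (t φ).center = 0 := rfl
@[simp] theorem shift_a : (a φ).shift = 0 := rfl
@[simp] theorem poly_a : (a φ).poly = 1 := rfl
@[simp] theorem center_a : (a φ).center = 0 := rfl

theorem t_pow (n : ℕ) : t φ ^ n = ⟨n, 0, 0⟩ := by
  induction n with
  | zero => rfl
  | succ n ih => rw [pow_succ, ih]; ext1 <;> simp

theorem commutatorElement_eq {g h : HallGroup φ} (hg : g.shift = 0) (hh : h.shift = 0) :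
    ⁅g, h⁆ = ⟨0, 0, φ (invert g.poly * h.poly) - φ (invert h.poly * g.poly)⟩ := by
  rw [commutatorElement_def]
  ext1
  · simp [hg, hh]
  · simp [hg, hh]
  · simp only [center_mul, center_inv, poly_mul, poly_inv, shift_inv, hg, hh, neg_zero,
      LaurentPolynomial.T_zero, one_mul, map_add, map_neg, add_mul, mul_neg, neg_mul]
    abel

theorem commutator_conj (k : ℕ) :
    ⁅a φ, (t φ ^ k)⁻¹ * a φ * t φ ^ k⁆ = ⟨0, 0, φ (T k) - φ (T (-k))⟩ := by
  rw [t_pow, commutatorElement_eq] <;> simp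

/-- Both entries of the outer commutator are conjugates of `⁅t, a⁆`, so this element lies in the
second derived subgroup; it is the witness against derived length 2. -/
theorem commutator_commutator_conj (k : ℕ) :
    (⁅⁅t φ, a φ⁆, (t φ ^ k)⁻¹ * ⁅t φ, a φ⁆ * t φ ^ k⁆).center =
      φ (T k * (T 1 - 1) * (T (-1) - 1)) - φ (T (-k) * (T 1 - 1) * (T (-1) - 1)) := by
  rw [t_pow, commutatorElement_eq (by simp [commutatorElement_def])
    (by simp [commutatorElement_def])]
  simp only [commutatorElement_def, poly_mul, poly_inv, shift_mul, shift_inv, shift_t, poly_t,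
    shift_a, poly_a]
  congr 2
  · simp
    ring
  · simp
    ring

/-! ### The cocycle given by a sequence of slopes. -/

/-- The homomorphism `p ↦ (pₙ)` with `pₙ` the coefficient at `2n + 2` plus `ρ n` times the
coefficient at `2n + 1`. -/
noncomputable def pairing (ρ : ℕ → ℝ) : ℤ[T;T⁻¹] →+ Lex (ℕ → ℝ) where
  toFun p := toLex fun n => p.coeff (2 * n + 2) + ρ n * p.coeff (2 * n + 1)
  map_zero' := by
    exact congrArg toLex (funext fun n => by simp)
  map_add' p q := by
    rw [← toLex_add]
    refine congrArg toLex (funext fun n => ?_)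
    simp only [AddMonoidAlgebra.coeff_add, Finsupp.add_apply, Pi.add_apply, Int.cast_add]
    ring

theorem ofLex_pairing (ρ : ℕ → ℝ) (p : ℤ[T;T⁻¹]) (n : ℕ) :
    ofLex (pairing ρ p) n = p.coeff (2 * n + 2) + ρ n * p.coeff (2 * n + 1) := rfl

/-- Only positive exponents are read, so in `commutator_conj` the term `φ (T (-k))` drops out and
the commutator has center `φ (T k)` when `k` is positive. -/
theorem pairing_T_of_nonpos (ρ : ℕ → ℝ) {k : ℤ} (hk : k ≤ 0) : pairing ρ (T k) = 0 := by
  apply ofLex.injective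
  ext n
  rw [ofLex_pairing, LaurentPolynomial.T_apply, LaurentPolynomial.T_apply, if_neg (by omega),
    if_neg (by omega)]
  simp only [Int.cast_zero, mul_zero, add_zero]
  rfl

theorem pairing_T_two_mul_add_two (ρ : ℕ → ℝ) (n : ℕ) :
    pairing ρ (T (2 * n + 2)) = toLex (Pi.single n 1) := by
  apply ofLex.injective
  ext m
  simp only [ofLex_pairing, LaurentPolynomial.T_apply, ofLex_toLex, Pi.single_apply]
  split_ifs <;> first | omega | simp_all

theorem pairing_T_two_mul_add_one (ρ : ℕ → ℝ) (n : ℕ) :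
    pairing ρ (T (2 * n + 1)) = toLex (Pi.single n (ρ n)) := by
  apply ofLex.injective
  ext m
  simp only [ofLex_pairing, LaurentPolynomial.T_apply, ofLex_toLex, Pi.single_apply]
  split_ifs <;> first | omega | simp_all

/-- The subgroup generated by the two standard generators. -/
noncomputable def twoGen (φ : ℤ[T;T⁻¹] →+ L) : Subgroup (HallGroup φ) :=
  Subgroup.closure {a φ, t φ}

theorem a_mem_twoGen : a φ ∈ twoGen φ := Subgroup.subset_closure (by simp)
theorem t_mem_twoGen : t φ ∈ twoGen φ := Subgroup.subset_closure (by simp)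

/-- The generators of `twoGen φ`. -/
noncomputable def gens (φ : ℤ[T;T⁻¹] →+ L) : Fin 2 → twoGen φ :=
  ![⟨a φ, a_mem_twoGen⟩, ⟨t φ, t_mem_twoGen⟩]

theorem generates_gens : Generates (gens φ) := by
  have h : Set.range (gens φ) = (↑) ⁻¹' ({a φ, t φ} : Set (HallGroup φ)) := by
    ext g
    simp [gens, Matrix.range_cons, Subtype.ext_iff, or_comm]
  rw [Generates, h]
  exact Subgroup.closure_closure_coe_preimage

theorem hasDerivedLength_twoGen (ρ : ℕ → ℝ) : HasDerivedLength (twoGen (pairing ρ)) 3 := by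
  refine ⟨derivedSeries_three _, fun m hm h => ?_⟩
  have h2 : derivedSeries (twoGen (pairing ρ)) 2 = ⊥ :=
    le_bot_iff.1 (h ▸ derivedSeries_antitone _ (by omega : m ≤ 2))
  let A := gens (pairing ρ) 0
  let B := gens (pairing ρ) 1
  have h1 : ⁅B, A⁆ ∈ derivedSeries (twoGen (pairing ρ)) 1 := by
    rw [derivedSeries_succ, derivedSeries_zero]
    exact Subgroup.commutator_mem_commutator trivial trivial
  -- With exponent 3 the center is the image of `2T³ - T⁴ - T²`, the reflected terms having
  -- nonpositive exponents. As `T¹` is absent, coordinate 0 is `-1` whatever `ρ` is.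
  have hc : ⁅⁅B, A⁆, (B ^ 3)⁻¹ * ⁅B, A⁆ * B ^ 3⁆ ∈ derivedSeries (twoGen (pairing ρ)) 2 := by
    rw [derivedSeries_succ]
    refine Subgroup.commutator_mem_commutator h1 ?_
    simpa using (derivedSeries_normal (twoGen (pairing ρ)) 1).conj_mem _ h1 (B ^ 3)⁻¹
  rw [h2, Subgroup.mem_bot] at hc
  have : ofLex (⁅⁅t (pairing ρ), a (pairing ρ)⁆,
      (t (pairing ρ) ^ 3)⁻¹ * ⁅t (pairing ρ), a (pairing ρ)⁆ * t (pairing ρ) ^ 3⁆).center 0 = 0 :=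
    congrFun (congrArg (fun g : twoGen (pairing ρ) =>
      ofLex (g : HallGroup (pairing ρ)).center) hc) 0
  have e (k : ℤ) : (T k * (T 1 - 1) * (T (-1) - 1) : ℤ[T;T⁻¹]) =
      T k + T k - T (k + 1) - T (k - 1) := by
    rw [LaurentPolynomial.T_add, LaurentPolynomial.T_sub]
    linear_combination T k * T_neg_mul_T 1
  rw [commutator_commutator_conj, e, e] at this
  simp only [map_sub, map_add] at this
  rw [pairing_T_of_nonpos ρ (by norm_num : (-((3 : ℕ) : ℤ) ≤ 0)),
    pairing_T_of_nonpos ρ (by norm_num : (-((3 : ℕ) : ℤ) + 1 ≤ 0)),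
    pairing_T_of_nonpos ρ (by norm_num : (-((3 : ℕ) : ℤ) - 1 ≤ 0))] at this
  simp only [ofLex_sub, ofLex_add, Pi.sub_apply, Pi.add_apply, ofLex_pairing,
    LaurentPolynomial.T_apply] at this
  norm_num at this

theorem isBiOrderable_subgroup [LinearOrder L] [IsOrderedAddMonoid L]
    (G : Subgroup (HallGroup φ)) : IsBiOrderable G :=
  ⟨fun g h => lexLE (g : HallGroup φ) h,
    { refl := fun _ => isBiOrder_lexLE.refl _
      trans := fun _ _ _ => isBiOrder_lexLE.trans _ _ _
      antisymm := fun _ _ h1 h2 => Subtype.ext (isBiOrder_lexLE.antisymm _ _ h1 h2)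
      total := fun _ _ => isBiOrder_lexLE.total _ _
      mul_left := fun _ _ _ => isBiOrder_lexLE.mul_left _ _ _
      mul_right := fun _ _ _ => isBiOrder_lexLE.mul_right _ _ _ }⟩

theorem isBiOrderable_twoGen (ρ : ℕ → ℝ) : IsBiOrderable (twoGen (pairing ρ)) :=
  isBiOrderable_subgroup _

end HallGroup

/-! ### Words, their coordinates, and the word problem. -/

theorem wordVal_cons {α G : Type*} [Group G] (x : α → G) (l : α × Bool)
    (w : List (α × Bool)) :
    wordVal x (l :: w) = (bif l.2 then x l.1 else (x l.1)⁻¹) * wordVal x w := by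
  simp [wordVal]

theorem wordVal_append {α G : Type*} [Group G] (x : α → G) (u v : List (α × Bool)) :
    wordVal x (u ++ v) = wordVal x u * wordVal x v := by
  simp [wordVal]

theorem wordVal_nil {α G : Type*} [Group G] (x : α → G) : wordVal x [] = 1 := by
  simp [wordVal]

namespace HallGroup

open scoped LaurentPolynomial commutatorElement
open LaurentPolynomial (T invert)

/-- The exponent of `a` in a letter. -/
def aExp (x : Fin 2 × Bool) : ℤ := if x.1 = 0 then if x.2 then 1 else -1 else 0

/-- The exponent of `t` in a letter. -/
def tExp (x : Fin 2 × Bool) : ℤ := if x.1 = 0 then 0 else if x.2 then 1 else -1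

/-- The exponent sum of `t` in a word. -/
def wordShift : List (Fin 2 × Bool) → ℤ
  | [] => 0
  | x :: w => tExp x + wordShift w

/-- The coefficient at `k` of the polynomial part of a word. -/
def wordCoeff (k : ℤ) : List (Fin 2 × Bool) → ℤ
  | [] => 0
  | x :: w => (if wordShift w = k then aExp x else 0) + wordCoeff k w

/-- The exponent in the central part of a word of the `k`-th commutator `⁅a, t⁻ᵏ a tᵏ⁆`. -/
def wordPairing (k : ℤ) : List (Fin 2 × Bool) → ℤ
  | [] => 0
  | x :: w => aExp x * wordCoeff (k + wordShift w) w + wordPairing k w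

theorem primrec_aExp : Primrec aExp := Primrec.dom_finite _

theorem primrec_tExp : Primrec tExp := Primrec.dom_finite _

theorem primrec_wordShift : Primrec wordShift := by
  refine Primrec.of_eq (Primrec.list_foldr (f := fun w : List (Fin 2 × Bool) => w)
    (g := fun _ => (0 : ℤ)) (h := fun _ p => tExp p.1 + p.2) .id (.const 0)
    (Primrec.int_add.comp (primrec_tExp.comp (Primrec.fst.comp .snd))
      (Primrec.snd.comp .snd))) fun w => ?_
  induction w with
  | nil => rfl
  | cons x w ih => rw [List.foldr_cons, ih]; rfl

theorem primrec_wordCoeff : Primrec₂ wordCoeff := by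
  refine Primrec.of_eq (Primrec.list_rec
    (f := fun p : ℤ × List (Fin 2 × Bool) => p.2) (g := fun _ => (0 : ℤ))
    (h := fun p q => (if wordShift q.2.1 = p.1 then aExp q.1 else 0) + q.2.2)
    .snd (.const 0)
    (Primrec.int_add.comp
      (Primrec.ite
        (Primrec.eq.comp
          (primrec_wordShift.comp (Primrec.fst.comp (Primrec.snd.comp .snd)))
          (Primrec.fst.comp .fst))
        (primrec_aExp.comp (Primrec.fst.comp .snd)) (.const 0))
      (Primrec.snd.comp (Primrec.snd.comp .snd)))) fun ⟨k, w⟩ => ?_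
  induction w with
  | nil => rfl
  | cons x w ih => exact congrArg (_ + ·) ih

theorem primrec_wordPairing : Primrec₂ wordPairing := by
  refine Primrec.of_eq (Primrec.list_rec
    (f := fun p : ℤ × List (Fin 2 × Bool) => p.2) (g := fun _ => (0 : ℤ))
    (h := fun p q => aExp q.1 * wordCoeff (p.1 + wordShift q.2.1) q.2.1 + q.2.2)
    .snd (.const 0)
    (Primrec.int_add.comp
      (Primrec.int_mul.comp
        (primrec_aExp.comp (Primrec.fst.comp .snd))
        (primrec_wordCoeff.comp
          (Primrec.int_add.comp (Primrec.fst.comp .fst)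
            (primrec_wordShift.comp (Primrec.fst.comp (Primrec.snd.comp .snd))))
          (Primrec.fst.comp (Primrec.snd.comp .snd))))
      (Primrec.snd.comp (Primrec.snd.comp .snd)))) fun ⟨k, w⟩ => ?_
  induction w with
  | nil => rfl
  | cons x w ih => exact congrArg (_ + ·) ih

theorem abs_tExp_le (x : Fin 2 × Bool) : |tExp x| ≤ 1 := by
  unfold tExp; split_ifs <;> simp

theorem abs_wordShift_le (w : List (Fin 2 × Bool)) : |wordShift w| ≤ w.length := by
  induction w with
  | nil => simp [wordShift]
  | cons x w ih =>
    have := abs_add_le (tExp x) (wordShift w)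
    have := abs_tExp_le x
    simp only [wordShift, List.length_cons, Nat.cast_add, Nat.cast_one]
    linarith

/-- The exponents that occur are `t`-exponent sums of proper suffixes, which are shorter than the
word. -/
theorem wordCoeff_eq_zero {w : List (Fin 2 × Bool)} {k : ℤ} (hk : w.length ≤ |k|) :
    wordCoeff k w = 0 := by
  induction w with
  | nil => rfl
  | cons x w ih =>
    rw [List.length_cons] at hk
    have := abs_wordShift_le w
    have hne : wordShift w ≠ k := by rintro rfl; omega
    rw [wordCoeff, if_neg hne, ih (by omega), add_zero]

theorem wordPairing_eq_zero {w : List (Fin 2 × Bool)} {k : ℤ} (hk : 2 * w.length ≤ |k|) :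
    wordPairing k w = 0 := by
  induction w with
  | nil => rfl
  | cons x w ih =>
    rw [List.length_cons] at hk
    have := abs_wordShift_le w
    rw [wordPairing, ih (by omega), wordCoeff_eq_zero, mul_zero, add_zero]
    have := abs_sub_abs_le_abs_sub k (-wordShift w)
    rw [abs_neg, sub_neg_eq_add] at this
    omega

theorem pairing_one (ρ : ℕ → ℝ) : pairing ρ 1 = 0 := by
  rw [← LaurentPolynomial.T_zero]; exact pairing_T_of_nonpos ρ le_rfl

theorem letter_eq (ρ : ℕ → ℝ) (x : Fin 2 × Bool) :
    ((bif x.2 then gens (pairing ρ) x.1 else (gens (pairing ρ) x.1)⁻¹ : twoGen (pairing ρ)) :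
      HallGroup (pairing ρ)) = ⟨tExp x, LaurentPolynomial.C (aExp x), 0⟩ := by
  obtain ⟨i, b⟩ := x
  fin_cases i <;> cases b <;> ext1 <;> simp [gens, tExp, aExp, pairing_one]

/-- The element of the Hall group represented by a word in its two standard generators. -/
noncomputable def hallVal (ρ : ℕ → ℝ) (w : List (Fin 2 × Bool)) : HallGroup (pairing ρ) :=
  (wordVal (gens (pairing ρ)) w : twoGen (pairing ρ))

theorem hallVal_nil (ρ : ℕ → ℝ) : hallVal ρ [] = 1 := by
  rw [hallVal, wordVal_nil, Subgroup.coe_one]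

theorem hallVal_cons (ρ : ℕ → ℝ) (x : Fin 2 × Bool) (w : List (Fin 2 × Bool)) :
    hallVal ρ (x :: w) =
      ⟨tExp x, LaurentPolynomial.C (aExp x), 0⟩ * hallVal ρ w := by
  rw [hallVal, wordVal_cons, Subgroup.coe_mul, letter_eq, hallVal]

theorem shift_hallVal (ρ : ℕ → ℝ) (w : List (Fin 2 × Bool)) :
    (hallVal ρ w).shift = wordShift w := by
  induction w with
  | nil => simp [hallVal_nil, wordShift]
  | cons x w ih => rw [hallVal_cons, shift_mul, ih, wordShift]

theorem coeff_T_mul_C (n k c : ℤ) :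
    (T n * LaurentPolynomial.C c : ℤ[T;T⁻¹]).coeff k = if n = k then c else 0 := by
  rw [mul_comm, ← LaurentPolynomial.single_eq_C_mul_T]
  exact Finsupp.single_apply

theorem coeff_C_mul_T_mul (n k c : ℤ) (p : ℤ[T;T⁻¹]) :
    (LaurentPolynomial.C c * T n * p : ℤ[T;T⁻¹]).coeff k = c * p.coeff (k - n) := by
  rw [← LaurentPolynomial.single_eq_C_mul_T, AddMonoidAlgebra.coeff_single_mul_apply,
    neg_add_eq_sub]

theorem coeff_poly_hallVal (ρ : ℕ → ℝ) (w : List (Fin 2 × Bool)) (k : ℤ) :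
    (hallVal ρ w).poly.coeff k = wordCoeff k w := by
  induction w with
  | nil => simp [hallVal_nil, wordCoeff]
  | cons x w ih =>
    rw [hallVal_cons, poly_mul, AddMonoidAlgebra.coeff_add, Finsupp.add_apply, ih,
      shift_hallVal, coeff_T_mul_C, wordCoeff]

/-- Prepending a letter with `a`-exponent `c` to a word with shift `s` and polynomial `q` adds `φ (c
T⁻ˢ q)`. The coefficient of `c T⁻ˢ q` at `k` is `c` times that of `q` at `k + s`, which is the
recursion of `wordPairing`. -/
theorem center_hallVal (ρ : ℕ → ℝ) (w : List (Fin 2 × Bool)) (n : ℕ) :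
    ofLex (hallVal ρ w).center n =
      wordPairing (2 * n + 2) w + ρ n * wordPairing (2 * n + 1) w := by
  induction w with
  | nil =>
    simp only [hallVal_nil, wordPairing, Int.cast_zero, mul_zero, add_zero]
    rfl
  | cons x w ih =>
    rw [hallVal_cons, center_mul, ofLex_add, Pi.add_apply, ofLex_add, Pi.add_apply, ih,
      shift_hallVal, ofLex_pairing, map_mul, LaurentPolynomial.invert_T,
      LaurentPolynomial.invert_C, mul_comm (T _), coeff_C_mul_T_mul, coeff_C_mul_T_mul,
      coeff_poly_hallVal, coeff_poly_hallVal, wordPairing, wordPairing, sub_neg_eq_add,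
      sub_neg_eq_add, ofLex_zero, Pi.zero_apply]
    push_cast
    ring

/-- The length bounds leave finitely many coordinates to check: exponents of absolute value below
the length (the range is offset by the length to reach negative ones), and central coordinates `n`
below the length, since `2n + 1` is at least twice the length for the others. -/
theorem wordVal_eq_one_iff (ρ : ℕ → ℝ) (w : List (Fin 2 × Bool)) :
    wordVal (gens (pairing ρ)) w = 1 ↔ wordShift w = 0 ∧
      (∀ k ∈ List.range (2 * w.length), wordCoeff ((k : ℤ) - w.length) w = 0) ∧
      ∀ n ∈ List.range w.length,
        (wordPairing (2 * n + 2) w + ρ n * wordPairing (2 * n + 1) w : ℝ) = 0 := by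
  rw [← Subtype.val_inj, HallGroup.ext_iff, ← hallVal, shift_hallVal]
  refine and_congr Iff.rfl (and_congr ⟨fun h k _ => ?_, fun h => ?_⟩ ⟨fun h n _ => ?_, fun h => ?_⟩)
  · rw [← coeff_poly_hallVal ρ, h]; simp
  · ext k
    rw [coeff_poly_hallVal]
    rcases lt_or_ge |k| w.length with hk | hk
    · have := abs_lt.1 hk
      have := h (k + w.length).toNat (by rw [List.mem_range]; omega)
      rw [Int.toNat_of_nonneg (by omega), add_sub_cancel_right] at this
      simpa using this
    · rw [wordCoeff_eq_zero hk]; simp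
  · rw [← center_hallVal, h]; rfl
  · apply ofLex.injective
    ext n
    rw [center_hallVal]
    rcases lt_or_ge n w.length with hn | hn
    · exact h n (List.mem_range.2 hn)
    · rw [wordPairing_eq_zero (by rw [abs_of_nonneg] <;> omega),
        wordPairing_eq_zero (by rw [abs_of_nonneg] <;> omega)]
      simp
      rfl

theorem isComputableWith_gens {ρ : ℕ → ℝ}
    (hρ : PrimrecPred fun p : ℕ × ℤ × ℤ => (p.2.1 : ℝ) + ρ p.1 * p.2.2 = 0) :
    IsComputableWith (gens (pairing ρ)) := by
  refine ⟨generates_gens, PrimrecPred.computablePred ?_⟩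
  refine PrimrecPred.of_eq ?_ fun w => (wordVal_eq_one_iff ρ w).symm
  refine (Primrec.eq.comp primrec_wordShift (.const 0)).and (.and ?_ ?_)
  · refine PrimrecRel.comp (PrimrecRel.forall_mem_list
      (R := fun (k : ℕ) (w : List (Fin 2 × Bool)) => wordCoeff ((k : ℤ) - w.length) w = 0) ?_)
      (Primrec.list_range.comp (Primrec.nat_mul.comp (.const 2) .list_length)) .id
    exact Primrec.eq.comp (primrec_wordCoeff.comp
      (Primrec.int_natCast_sub.comp .fst (Primrec.list_length.comp .snd)) .snd) (.const 0)
  · refine PrimrecRel.comp (PrimrecRel.forall_mem_list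
      (R := fun (n : ℕ) (w : List (Fin 2 × Bool)) =>
        (wordPairing (2 * n + 2) w + ρ n * wordPairing (2 * n + 1) w : ℝ) = 0) ?_)
      (Primrec.list_range.comp .list_length) .id
    have idx (i : ℤ) : Primrec fun p : ℕ × List (Fin 2 × Bool) =>
        wordPairing (2 * (p.1 : ℤ) + i) p.2 :=
      primrec_wordPairing.comp (Primrec.int_add.comp (Primrec.int_mul.comp (.const 2)
        (Primrec.int_ofNat.comp .fst)) (.const i)) .snd
    exact hρ.comp (Primrec.pair .fst ((idx 2).pair (idx 1)))

end HallGroup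

/-! ### Slopes that encode the diagonal halting problem. -/

open Nat.Partrec (Code)

/-- The `n`-th program halts on input `n` with output `v` after exactly `s + 1` steps. -/
def HaltsAt (n s v : ℕ) : Prop :=
  Code.evaln s (Denumerable.ofNat Code n) n = none ∧
    Code.evaln (s + 1) (Denumerable.ofNat Code n) n = some v

theorem primrecPred_haltsAt (v : ℕ) : PrimrecPred fun p : ℕ × ℕ => HaltsAt p.1 p.2 v := by
  have e (f : ℕ → ℕ) (hf : Primrec f) : Primrec fun p : ℕ × ℕ =>
      Code.evaln (f p.2) (Denumerable.ofNat Code p.1) p.1 :=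
    Code.primrec_evaln.comp (Primrec.pair (Primrec.pair (hf.comp .snd)
      ((Primrec.ofNat Code).comp .fst)) .fst)
  exact (Primrec.eq.comp (e _ .id) (.const none)).and
    (Primrec.eq.comp (e _ .succ) (.const (some v)))

/-- A value found by `evaln` persists under larger bounds, so the first successful bound and its
value are determined. -/
theorem HaltsAt.unique {n s v s' v' : ℕ} (h : HaltsAt n s v) (h' : HaltsAt n s' v') :
    s = s' ∧ v = v' := by
  have lt {s v s' v' : ℕ} (h : HaltsAt n s v) (h' : HaltsAt n s' v') : ¬ s < s' := fun hlt => by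
    have := Code.evaln_mono (Nat.succ_le_of_lt hlt) (Option.mem_def.2 h.2)
    rw [Option.mem_def, h'.1] at this
    cases this
  obtain rfl : s = s' := le_antisymm (not_lt.1 (lt h' h)) (not_lt.1 (lt h h'))
  exact ⟨rfl, Option.some.inj (h.2.symm.trans h'.2)⟩

open Classical in
/-- The number `s + 1` if the `n`-th program halts on `n` with output `0` in `s + 1` steps,
`-(s + 1)` if it does so with output `1`, and `√2` otherwise. -/
noncomputable def haltingSlope (n : ℕ) : ℝ :=
  if h : ∃ s, HaltsAt n s 0 then (h.choose + 1 : ℕ)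
  else if h : ∃ s, HaltsAt n s 1 then -(h.choose + 1 : ℕ)
  else √2

theorem haltingSlope_of_zero {n s : ℕ} (h : HaltsAt n s 0) :
    haltingSlope n = (s + 1 : ℕ) := by
  have hex : ∃ s, HaltsAt n s 0 := ⟨s, h⟩
  rw [haltingSlope, dif_pos hex, (hex.choose_spec.unique h).1]

theorem haltingSlope_of_one {n s : ℕ} (h : HaltsAt n s 1) :
    haltingSlope n = -(s + 1 : ℕ) := by
  have hex : ∃ s, HaltsAt n s 1 := ⟨s, h⟩
  rw [haltingSlope, dif_neg fun ⟨_, h0⟩ => zero_ne_one (h0.unique h).2, dif_pos hex,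
    (hex.choose_spec.unique h).1]

theorem haltingSlope_ne_zero (n : ℕ) : haltingSlope n ≠ 0 := by
  unfold haltingSlope
  split_ifs
  · positivity
  · exact neg_ne_zero.2 (by positivity)
  · positivity

/-- If `c ≠ 0` and the slope is `±(s + 1)`, then `|c| = (s + 1) |d| ≥ s + 1`, which bounds the
search for `s`. The slope `√2` admits no relation with `c ≠ 0`, being irrational. The right-hand
side is thus decidable although the slope itself is not computable. -/
theorem add_haltingSlope_mul_eq_zero_iff (n : ℕ) (c d : ℤ) :
    (c : ℝ) + haltingSlope n * d = 0 ↔ (c = 0 ∧ d = 0) ∨ ∃ s ∈ List.range c.natAbs,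
      (HaltsAt n s 0 ∧ c + (s + 1) * d = 0) ∨ (HaltsAt n s 1 ∧ c - (s + 1) * d = 0) := by
  constructor
  · intro h
    rcases eq_or_ne c 0 with rfl | hc
    · left
      simpa [haltingSlope_ne_zero] using h
    · right
      have bound {s : ℕ} (hs : |c| = (s + 1) * |d|) : s ∈ List.range c.natAbs := by
        have hd : 0 < |d| := abs_pos.2 fun hd => hc (by simpa [hd] using hs)
        have : (s + 1 : ℤ) ≤ |c| := by rw [hs]; nlinarith
        rw [List.mem_range]
        zify
        linarith
      by_cases h0 : ∃ s, HaltsAt n s 0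
      · obtain ⟨s, hs⟩ := h0
        rw [haltingSlope_of_zero hs] at h
        have h : c + (s + 1) * d = 0 := by exact_mod_cast h
        refine ⟨s, bound ?_, .inl ⟨hs, h⟩⟩
        rw [eq_neg_of_add_eq_zero_left h, abs_neg, abs_mul, abs_of_nonneg (by positivity)]
      · by_cases h1 : ∃ s, HaltsAt n s 1
        · obtain ⟨s, hs⟩ := h1
          rw [haltingSlope_of_one hs, neg_mul, ← sub_eq_add_neg] at h
          have h : c - (s + 1) * d = 0 := by exact_mod_cast h
          refine ⟨s, bound ?_, .inr ⟨hs, h⟩⟩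
          rw [sub_eq_zero.1 h, abs_mul, abs_of_nonneg (by positivity)]
        · rw [haltingSlope, dif_neg h0, dif_neg h1] at h
          rcases eq_or_ne d 0 with rfl | hd
          · simp [hc] at h
          · exact (((irrational_sqrt_two.mul_intCast hd).intCast_add c).ne_zero h).elim
  · rintro (⟨rfl, rfl⟩ | ⟨s, -, ⟨hs, h⟩ | ⟨hs, h⟩⟩)
    · simp
    · rw [haltingSlope_of_zero hs]
      exact_mod_cast h
    · rw [haltingSlope_of_one hs, neg_mul, ← sub_eq_add_neg]
      exact_mod_cast h

theorem primrecPred_add_haltingSlope_mul_eq_zero :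
    PrimrecPred fun p : ℕ × ℤ × ℤ => (p.2.1 : ℝ) + haltingSlope p.1 * p.2.2 = 0 := by
  refine PrimrecPred.of_eq ?_ fun p => (add_haltingSlope_mul_eq_zero_iff p.1 p.2.1 p.2.2).symm
  refine ((Primrec.eq.comp (Primrec.fst.comp .snd) (.const 0)).and
    (Primrec.eq.comp (Primrec.snd.comp .snd) (.const 0))).or ?_
  refine PrimrecRel.comp (PrimrecRel.exists_mem_list
    (R := fun (s : ℕ) (p : ℕ × ℤ × ℤ) =>
      (HaltsAt p.1 s 0 ∧ p.2.1 + (s + 1) * p.2.2 = 0) ∨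
        (HaltsAt p.1 s 1 ∧ p.2.1 - (s + 1) * p.2.2 = 0)) ?_)
    (Primrec.list_range.comp (Primrec.int_natAbs.comp (Primrec.fst.comp .snd))) .id
  have halts (v : ℕ) : PrimrecPred fun q : ℕ × ℕ × ℤ × ℤ => HaltsAt q.2.1 q.1 v :=
    (primrecPred_haltsAt v).comp (Primrec.pair (Primrec.fst.comp .snd) .fst)
  have c : Primrec fun q : ℕ × ℕ × ℤ × ℤ => q.2.2.1 := Primrec.fst.comp (Primrec.snd.comp .snd)
  have d : Primrec fun q : ℕ × ℕ × ℤ × ℤ => ((q.1 : ℤ) + 1) * q.2.2.2 :=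
    Primrec.int_mul.comp
      (Primrec.int_add.comp (Primrec.int_ofNat.comp .fst) (.const 1))
      (Primrec.snd.comp (Primrec.snd.comp .snd))
  exact PrimrecPred.or
    ((halts 0).and (Primrec.eq.comp (Primrec.int_add.comp c d) (.const 0)))
    ((halts 1).and (Primrec.eq.comp (Primrec.int_sub.comp c d) (.const 0)))

/-- No computable function differs everywhere from the diagonal halting value. -/
theorem exists_haltsAt_of_computable {g : ℕ → ℕ} (hg : Computable g) :
    ∃ n s, HaltsAt n s (g n) := by
  obtain ⟨c, hc⟩ := Code.exists_code.1 (Partrec.nat_iff.1 hg.partrec)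
  refine ⟨Encodable.encode c, ?_⟩
  have hex : ∃ k, g (Encodable.encode c) ∈ Code.evaln k c (Encodable.encode c) := by
    rw [← Code.evaln_complete, hc]
    exact Part.mem_some _
  classical
  -- The least successful bound is a successor `s + 1`, as bound 0 never succeeds; a value at bound
  -- `s` would equal `g` by monotonicity and contradict minimality.
  have hfind := Nat.find_spec hex
  have hmin := fun k => Nat.find_min hex (m := k)
  generalize Nat.find hex = k at hfind hmin
  cases k with
  | zero => simp [Code.evaln] at hfind
  | succ s =>
    refine ⟨s, ?_, by rw [Denumerable.ofNat_encode]; exact hfind⟩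
    rw [Denumerable.ofNat_encode, Option.eq_none_iff_forall_not_mem]
    intro v hv
    have := Code.evaln_mono s.le_succ hv
    rw [Option.mem_def] at this hfind
    rw [hfind] at this
    obtain rfl := Option.some.inj this
    exact hmin s s.lt_succ_self hv

/-! ### Signs of powers and inverses in a bi-order. -/

namespace IsBiOrder

variable {G : Type*} [Group G] {le : G → G → Prop}

theorem one_le_pow (h : IsBiOrder le) {y : G} (hy : le 1 y) (m : ℕ) : le 1 (y ^ m) := by
  induction m with
  | zero => rw [pow_zero]; exact h.refl 1
  | succ m ih =>
    refine h.trans _ _ _ hy ?_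
    simpa [pow_succ] using h.mul_right _ _ y ih

theorem pow_le_one (h : IsBiOrder le) {y : G} (hy : le y 1) (m : ℕ) : le (y ^ m) 1 := by
  induction m with
  | zero => rw [pow_zero]; exact h.refl 1
  | succ m ih =>
    refine h.trans _ _ _ ?_ hy
    simpa [pow_succ] using h.mul_right _ _ y ih

theorem one_le_inv_iff (h : IsBiOrder le) (y : G) : le 1 y⁻¹ ↔ le y 1 :=
  ⟨fun hy => by simpa using h.mul_left _ _ y hy, fun hy => by simpa using h.mul_left _ _ y⁻¹ hy⟩

theorem one_le_pow_iff (h : IsBiOrder le) {y : G} {m : ℕ} (hne : y ^ m ≠ 1) :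
    le 1 (y ^ m) ↔ le 1 y := by
  refine ⟨fun hm => ?_, fun hy => h.one_le_pow hy m⟩
  by_contra hy
  exact hne (h.antisymm _ _ (h.pow_le_one ((h.total 1 y).resolve_left hy) m) hm)

theorem one_le_inv_iff_not (h : IsBiOrder le) {y : G} (hne : y ≠ 1) :
    le 1 y⁻¹ ↔ ¬ le 1 y := by
  rw [h.one_le_inv_iff]
  exact ⟨fun h1 h2 => hne (h.antisymm _ _ h1 h2), fun h1 => (h.total 1 y).resolve_left h1⟩

end IsBiOrder

/-! ### Words over an arbitrary generating family. -/

theorem Generates.exists_wordVal_eq {α G : Type*} [Group G] {x : α → G} (hx : Generates x)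
    (g : G) : ∃ w, wordVal x w = g := by
  have hg : g ∈ (FreeGroup.lift x).range := by
    rw [FreeGroup.range_lift_eq_closure, hx]; trivial
  obtain ⟨u, rfl⟩ := hg
  obtain ⟨w, rfl⟩ := Quot.exists_rep u
  exact ⟨w, rfl⟩

/-- The words `u ^ k`, uniformly in `k`. -/
def wordPow {α : Type*} (u : List α) (k : ℕ) : List α :=
  Nat.rec [] (fun _ v => v ++ u) k

theorem primrec_wordPow {α : Type*} [Primcodable α] (u : List α) : Primrec (wordPow u) :=
  Primrec.nat_rec₁ [] (Primrec.list_append.comp .snd (.const u))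

theorem wordVal_wordPow {α G : Type*} [Group G] (x : α → G) (u : List (α × Bool)) (k : ℕ) :
    wordVal x (wordPow u k) = wordVal x u ^ k := by
  induction k with
  | zero => rw [pow_zero]; exact wordVal_nil x
  | succ k ih => rw [pow_succ, ← ih]; exact wordVal_append x _ _

open scoped commutatorElement in
-- Four fixed words, for `a`, `t` and their inverses, suffice to write all these commutators
-- uniformly in `k`. This makes the diagonal argument independent of the generating family, even an
-- infinite one.
theorem Generates.exists_computable_wordVal_eq_commutator {α G : Type*} [Primcodable α] [Group G]
    {x : α → G} (hx : Generates x) (a t : G) :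
    ∃ W : ℕ → List (α × Bool), Computable W ∧
      ∀ k, wordVal x (W k) = ⁅a, (t ^ k)⁻¹ * a * t ^ k⁆ := by
  obtain ⟨A, hA⟩ := hx.exists_wordVal_eq a
  obtain ⟨A', hA'⟩ := hx.exists_wordVal_eq a⁻¹
  obtain ⟨B, hB⟩ := hx.exists_wordVal_eq t
  obtain ⟨B', hB'⟩ := hx.exists_wordVal_eq t⁻¹
  refine ⟨fun k => A ++ (wordPow B' k ++ (A ++ (wordPow B k ++
    (A' ++ (wordPow B' k ++ (A' ++ wordPow B k)))))), Primrec.to_comp ?_, fun k => ?_⟩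
  · have p (u : List (α × Bool)) := primrec_wordPow u
    have c (u : List (α × Bool)) : Primrec fun _ : ℕ => u := .const u
    have app {f g : ℕ → List (α × Bool)} (hf : Primrec f) (hg : Primrec g) :
        Primrec fun k => f k ++ g k := Primrec.list_append.comp hf hg
    exact app (c A) (app (p B') (app (c A) (app (p B) (app (c A') (app (p B')
      (app (c A') (p B)))))))
  · simp only [wordVal_append, wordVal_wordPow, hA, hA', hB, hB', commutatorElement_def]
    group

/-! ### No bi-order is computable. -/

namespace HallGroup

open scoped LaurentPolynomial commutatorElement

variable {L : Type*} [AddCommGroup L] {φ : ℤ[T;T⁻¹] →+ L}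

theorem central_pow (z : L) (m : ℕ) : (⟨0, 0, z⟩ : HallGroup φ) ^ m = ⟨0, 0, m • z⟩ := by
  induction m with
  | zero => rw [pow_zero, zero_smul]; rfl
  | succ m ih => rw [pow_succ, ih]; ext1 <;> simp [add_smul]

theorem central_inv (z : L) : (⟨0, 0, z⟩ : HallGroup φ)⁻¹ = ⟨0, 0, -z⟩ := by
  ext1 <;> simp

theorem commutator_conj_two_mul_add_one (ρ : ℕ → ℝ) (n : ℕ) :
    ⁅a (pairing ρ), (t (pairing ρ) ^ (2 * n + 1))⁻¹ * a (pairing ρ) * t (pairing ρ) ^ (2 * n + 1)⁆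
      = ⟨0, 0, toLex (Pi.single n (ρ n))⟩ := by
  rw [commutator_conj, pairing_T_of_nonpos ρ (k := -_) (by omega), sub_zero,
    ← pairing_T_two_mul_add_one]
  norm_cast

theorem commutator_conj_two_mul_add_two (ρ : ℕ → ℝ) (n : ℕ) :
    ⁅a (pairing ρ), (t (pairing ρ) ^ (2 * n + 2))⁻¹ * a (pairing ρ) * t (pairing ρ) ^ (2 * n + 2)⁆
      = ⟨0, 0, toLex (Pi.single n 1)⟩ := by
  rw [commutator_conj, pairing_T_of_nonpos ρ (k := -_) (by omega), sub_zero,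
    ← pairing_T_two_mul_add_two]
  norm_cast

theorem nsmul_toLex_single (m n : ℕ) :
    m • toLex (Pi.single n 1 : ℕ → ℝ) = toLex (Pi.single n (m : ℝ)) :=
  congrArg toLex (show m • (Pi.single n 1 : ℕ → ℝ) = _ by rw [← Pi.single_smul, nsmul_one])

theorem not_hasComputableBiOrder_twoGen_haltingSlope :
    ¬ HasComputableBiOrder (twoGen (pairing haltingSlope)) := by
  rintro ⟨α, _, x, le, hle, hx, hcomp⟩
  let A := gens (pairing haltingSlope) 0
  let B := gens (pairing haltingSlope) 1
  obtain ⟨W, hW, hWval⟩ := hx.exists_computable_wordVal_eq_commutator A B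
  obtain ⟨f, hf, hfeq⟩ := ComputablePred.computable_iff.1 hcomp
  let X (n : ℕ) := wordVal x (W (2 * n + 1))
  let Y (n : ℕ) := wordVal x (W (2 * n + 2))
  have hX (n : ℕ) : (X n : HallGroup (pairing haltingSlope)) =
      ⟨0, 0, toLex (Pi.single n (haltingSlope n))⟩ := by
    rw [← commutator_conj_two_mul_add_one]
    exact congrArg Subtype.val (hWval _)
  have hY (n : ℕ) : (Y n : HallGroup (pairing haltingSlope)) =
      ⟨0, 0, toLex (Pi.single n 1)⟩ := by
    rw [← commutator_conj_two_mul_add_two]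
    exact congrArg Subtype.val (hWval _)
  have hX1 (n : ℕ) : X n ≠ 1 := fun h => by
    have h := (hX n).symm.trans (congrArg Subtype.val h)
    have : Pi.single (M := fun _ => ℝ) n (haltingSlope n) n = 0 :=
      congrFun (congrArg ofLex (congrArg center h)) n
    exact haltingSlope_ne_zero n (by simpa using this)
  have hfX (k : ℕ) : f ([], W k) = true ↔ le 1 (wordVal x (W k)) := by
    rw [← wordVal_nil x]
    exact (iff_of_eq (congrFun hfeq ([], W k))).symm
  -- Comparison with the empty word decides the sign. The value is opposite to the convention of
  -- `haltingSlope`: equal signs give 1, but output 1 makes `X n` a negative power of `Y n`.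
  let g (n : ℕ) : ℕ := bif f ([], W (2 * n + 1)) == f ([], W (2 * n + 2)) then 1 else 0
  have hg : Computable g := by
    have p (i : ℕ) : Computable fun n => f ([], W (2 * n + i)) :=
      hf.comp ((Computable.const []).pair (hW.comp (Primrec.nat_add.comp
        (Primrec.nat_mul.comp (.const 2) .id) (.const i)).to_comp))
    exact Computable.cond ((Primrec.dom_bool₂ (· == ·)).to_comp.comp (p 1) (p 2))
      (.const 1) (.const 0)
  obtain ⟨n, s, hs⟩ := exists_haltsAt_of_computable hg
  by_cases hiff : le 1 (X n) ↔ le 1 (Y n)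
  · have hgn : g n = 1 := by
      have : f ([], W (2 * n + 1)) = f ([], W (2 * n + 2)) :=
        Bool.eq_iff_iff.2 (((hfX _).trans hiff).trans (hfX _).symm)
      simp [g, this]
    rw [hgn] at hs
    have hXY : X n = (Y n ^ (s + 1))⁻¹ := by
      apply Subtype.ext
      rw [Subgroup.coe_inv, Subgroup.coe_pow, hX, hY, central_pow, central_inv,
        haltingSlope_of_one hs, nsmul_toLex_single, ← toLex_neg, ← Pi.single_neg]
    have hne : Y n ^ (s + 1) ≠ 1 := fun h => hX1 n (by rw [hXY, h, inv_one])
    rw [hXY, hle.one_le_inv_iff_not hne, hle.one_le_pow_iff hne] at hiff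
    tauto
  · have hgn : g n = 0 := by
      have : f ([], W (2 * n + 1)) ≠ f ([], W (2 * n + 2)) := fun h =>
        hiff (((hfX _).symm.trans (Bool.eq_iff_iff.1 h)).trans (hfX _))
      dsimp only [g]
      rw [beq_eq_false_iff_ne.2 this, cond_false]
    rw [hgn] at hs
    have hXY : X n = Y n ^ (s + 1) := by
      apply Subtype.ext
      rw [Subgroup.coe_pow, hX, hY, central_pow, haltingSlope_of_zero hs, nsmul_toLex_single]
    have hne := hX1 n
    rw [hXY] at hne
    exact hiff (hXY ▸ hle.one_le_pow_iff hne)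

end HallGroup

theorem corollary1 :
    ∃ (G : Type) (_ : Group G),
      IsComputableGroup G ∧ IsBiOrderable G ∧ ¬ HasComputableBiOrder G ∧
      (∃ x : Fin 2 → G, IsComputableWith x) ∧ HasDerivedLength G 3 :=
  have h := HallGroup.isComputableWith_gens primrecPred_add_haltingSlope_mul_eq_zero
  ⟨HallGroup.twoGen (HallGroup.pairing haltingSlope), inferInstance, ⟨Fin 2, inferInstance, _, h⟩,
    HallGroup.isBiOrderable_twoGen _, HallGroup.not_hasComputableBiOrder_twoGen_haltingSlope,
    ⟨_, h⟩, HallGroup.hasDerivedLength_twoGen _⟩
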